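/- A \emph{grid} is one of three graphs with vertex set $\mathbb{Z}^2$: the square grid $\mathcal{S}$, in which $(i,j)$ and $(k,l)$ are adjacent when $|i-k|+|j-l|=1$; the triangular grid $\mathcal{T}$, obtained from $\mathcal{S}$ by adding all edges $(i,j)(k,l)$ with $k-i=j-l=1$; the king grid $\mathcal{K}$, obtained from $\mathcal{T}$ by adding all edges $(i,j)(k,l)$ with $k-i=l-j=1$. For a grid $\mathcal{G}$ and $h,s\ge 1$, let $\mathcal{G}_{h,s}$ be the subgraph of $\mathcal{G}$ induced by $\{1,\dots,h\}\times\{1,\dots,s\}$; the vertices $(i,j)$ with $j=k$ form its $k$-th column. A $2$-labeling of $\mathcal{G}_{h,s}$ is a map from its vertices to $\{0,1\}$. A set $C$ of vertices dominates a vertex $v$ if $N[v]\cap C\ne\emptyset$, and it separates two distinct vertices $u,v$ if $N[u]\cap C\ne N[v]\cap C$, where $N[\cdot]$ denotes the closed neighborhood. The \emph{auxiliary graph} $\vec{\mathcal{G}}^{I}_h$ for identifying codes (ID-codes) in strips of height $h$ is the following directed graph (loops allowed) with a length function on the arcs. Its vertices are all the $2$-labelings of $\mathcal{G}_{h,4}$.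 A pair $(f,f')$ of (not necessarily distinct) vertices is an arc when $f$ labels the last three columns exactly as $f'$ labels the first three columns, and, in the $2$-labeling $f\triangleright f'$ of $\mathcal{G}_{h,5}$ that equals $f$ on the first four columns and $f'$ on the last four, the set of vertices labeled $1$ dominates every vertex of columns $2,3,4$ and separates every two distinct vertices of columns $2,3,4$ (domination and separation in $\mathcal{G}_{h,5}$). The length $\ell(f,f')$ of the arc is the number of vertices of the fifth column labeled $1$ by $f\triangleright f'$. The \emph{length-matrix} $\Pi$ of a finite directed graph with arc lengths in $\mathbb{N}$ is the square matrix over $\mathbb{N}\cup\{\infty\}$, indexed by the vertices, with $\Pi_{u,v}=\ell(u,v)$ if $(u,v)$ is an arc and $\Pi_{u,v}=\infty$ otherwise. Matrices over $\mathbb{N}\cup\{\infty\}$ are multiplied by the min-plus rule $[AB]_{u,v}=\min_{w}(A_{u,w}+B_{w,v})$, and $A+c$ denotes the matrix with entries $A_{u,v}+c$. Such a matrix $\Pi$ is \emph{stable} if there are integers $c\ge 0$, $p\ge 1$ and $u\ge 1$ such that $\Pi^{i+p}=\Pi^{i}+c$ for all $i\ge u$. \textbf{Theorem.} For every grid $\mathcal{G}$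 and every integer $h\ge 1$, the length-matrix of the auxiliary graph $\vec{\mathcal{G}}^{I}_h$ is stable. -/

import Mathlib

namespace IDStrip

/-! ### Codes in graphs -/

/-- The closed neighbourhood `N_G[v]`. -/
def closedNeighborSet {V : Type*} (G : SimpleGraph V) (v : V) : Set V :=
  insert v (G.neighborSet v)

/-- `v` is dominated by the code `C` in `G`. -/
def IsDominatedBy {V : Type*} (G : SimpleGraph V) (C : Set V) (v : V) : Prop :=
  (closedNeighborSet G v ∩ C).Nonempty

/-- `u` and `v` are separated by the code `C` in `G`. -/
def AreSeparatedBy {V : Type*} (G : SimpleGraph V) (C : Set V) (u v : V) : Prop :=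
  closedNeighborSet G u ∩ C ≠ closedNeighborSet G v ∩ C

/-! ### Grids and strips -/

/-- The three kinds of grids. -/
inductive Grid where
  | square
  | triangular
  | king

/-- The square grid: `(i,j)` and `(k,l)` are adjacent when `|i-k| + |j-l| = 1`. -/
def squareGrid : SimpleGraph (ℤ × ℤ) :=
  SimpleGraph.fromRel fun a b => |a.1 - b.1| + |a.2 - b.2| = 1

/-- The triangular grid: the square grid together with all edges `(i,j)(k,l)` such that
`k - i = j - l = 1`. -/
def triangularGrid : SimpleGraph (ℤ × ℤ) :=
  squareGrid ⊔ SimpleGraph.fromRel fun a b => b.1 - a.1 = 1 ∧ a.2 - b.2 = 1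

/-- The king grid: the triangular grid together with all edges `(i,j)(k,l)` such that
`k - i = l - j = 1`. -/
def kingGrid : SimpleGraph (ℤ × ℤ) :=
  triangularGrid ⊔ SimpleGraph.fromRel fun a b => b.1 - a.1 = 1 ∧ b.2 - a.2 = 1

/-- The infinite graph on `ℤ × ℤ` of each grid. -/
def Grid.graph : Grid → SimpleGraph (ℤ × ℤ)
  | .square => squareGrid
  | .triangular => triangularGrid
  | .king => kingGrid

/-- The points `(i, j)` with `1 ≤ i ≤ h` and `1 ≤ j ≤ s`; `j` is the number of the column. -/
noncomputable def stripPoints (h s : ℕ) : Finset (ℤ × ℤ) :=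
  Finset.Icc (1 : ℤ) h ×ˢ Finset.Icc (1 : ℤ) s

/-- The vertices of the finite strip of height `h` and size `s`. -/
abbrev StripVertex (h s : ℕ) : Type := {a : ℤ × ℤ // a ∈ stripPoints h s}

/-- The finite strip of height `h` and size `s`: the subgraph of the grid induced by
`stripPoints h s`. -/
def strip (𝒢 : Grid) (h s : ℕ) : SimpleGraph (StripVertex h s) :=
  𝒢.graph.comap Subtype.val

/-! ### Labelings -/

/-- The `2`-labelings of the strip of height `h` and size `s`. -/
abbrev Labeling (h s : ℕ) : Type := StripVertex h s → Fin 2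

/-- The code `C_f` of a `2`-labeling: the vertices labeled `1`. -/
def Labeling.code {h s : ℕ} (f : Labeling h s) : Set (StripVertex h s) := {v | f v = 1}

theorem shift_mem {h s a t : ℕ} (hat : a + t ≤ s) (v : StripVertex h t) :
    (v.1.1, v.1.2 + (a : ℤ)) ∈ stripPoints h s := by
  have := v.2
  simp only [stripPoints, Finset.mem_product, Finset.mem_Icc] at this ⊢
  omega

/-- The restriction of `f` to the `t` consecutive columns `a + 1, …, a + t`, renumbered
`1, …, t`. -/
def Labeling.restrict {h s : ℕ} (f : Labeling h s) (a t : ℕ) (hat : a + t ≤ s) :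
    Labeling h t :=
  fun v => f ⟨(v.1.1, v.1.2 + (a : ℤ)), shift_mem hat v⟩

/-- The property `P^I` of a `2`-labeling `f` of a strip of size `s`: for every substrip `F` of
five consecutive columns `a + 1, …, a + 5`, the vertices of its three middle columns
`a + 2, a + 3, a + 4` are dominated, and pairwise separated, by the vertices of `C_f` that are
in `F`. -/
def SatisfiesPI (𝒢 : Grid) {h s : ℕ} (f : Labeling h s) : Prop :=
  ∀ a : ℕ, a + 5 ≤ s →
    let F : Set (StripVertex h s) := {v | (a : ℤ) + 1 ≤ v.1.2 ∧ v.1.2 ≤ (a : ℤ) + 5}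
    let M : Set (StripVertex h s) := {v | (a : ℤ) + 2 ≤ v.1.2 ∧ v.1.2 ≤ (a : ℤ) + 4}
    (∀ v ∈ M, IsDominatedBy (strip 𝒢 h s) (f.code ∩ F) v) ∧
      ∀ u ∈ M, ∀ v ∈ M, u ≠ v → AreSeparatedBy (strip 𝒢 h s) (f.code ∩ F) u v

/-- `f` labels the last three columns exactly as `g` labels the first three. -/
def Compatible {h : ℕ} (f g : Labeling h 4) : Prop :=
  f.restrict 1 3 (by norm_num) = g.restrict 0 3 (by norm_num)

/-- The concatenation `f ▷ g`: it is given by `f` on the first four columns and by the last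
column of `g` on the fifth. For compatible `f` and `g` it therefore agrees with `g` on the last
four columns. -/
def concat {h : ℕ} (f g : Labeling h 4) : Labeling h 5 := fun v =>
  if hv : v.1.2 ≤ 4 then
    f ⟨v.1, by
      have := v.2
      simp only [stripPoints, Finset.mem_product, Finset.mem_Icc] at this ⊢
      omega⟩
  else
    g ⟨(v.1.1, v.1.2 - 1), by
      have := v.2
      simp only [stripPoints, Finset.mem_product, Finset.mem_Icc] at this ⊢
      omega⟩

/-- `f` is `I`-compatible with `g`. -/
def ICompatible (𝒢 : Grid) {h : ℕ} (f g : Labeling h 4) : Prop :=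
  Compatible f g ∧ SatisfiesPI 𝒢 (concat f g)

/-! ### Directed graphs with a length function, and their length-matrices -/

/-- A directed graph (loops allowed) with a length in `ℕ` on each arc. -/
structure LengthDigraph (V : Type*) extends Digraph V where
  /-- The length of an arc. -/
  length : ∀ u v : V, Adj u v → ℕ

/-- Square matrices over `ℕ ∪ {∞}` with the min-plus product: in `Tropical ℕ∞` addition is `min`
and multiplication is the addition of `ℕ∞`. -/
abbrev MinPlusMatrix (V : Type*) : Type _ := Matrix V V (Tropical ℕ∞)

open Classical in
/-- The length-matrix: `ℓ(u, v)` if `(u, v)` is an arc, and `∞` otherwise. -/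
noncomputable def LengthDigraph.lengthMatrix {V : Type*} (G : LengthDigraph V) :
    MinPlusMatrix V := fun u v =>
  if huv : G.Adj u v then Tropical.trop (G.length u v huv : ℕ∞) else Tropical.trop ⊤

/-- The translation `A + c`: the integer `c` is added to each entry of `A`. -/
def MinPlusMatrix.translate {V : Type*} (A : MinPlusMatrix V) (c : ℕ) : MinPlusMatrix V :=
  fun u v => Tropical.trop (Tropical.untrop (A u v) + (c : ℕ∞))

/-- `A` is `(c, p, u)`-stable: the period `p` is positive and `A ^ (i + p) = A ^ i + c` for all
`i ≥ u`. As only positive powers of `A` are considered, the start `u` is positive. -/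
def MinPlusMatrix.IsStableWith {V : Type*} [Fintype V] [DecidableEq V] (A : MinPlusMatrix V)
    (c p u : ℕ) : Prop :=
  1 ≤ p ∧ 1 ≤ u ∧ ∀ i : ℕ, u ≤ i → A ^ (i + p) = MinPlusMatrix.translate (A ^ i) c

/-- `A` is stable. -/
def MinPlusMatrix.IsStable {V : Type*} [Fintype V] [DecidableEq V] (A : MinPlusMatrix V) :
    Prop :=
  ∃ c p u : ℕ, MinPlusMatrix.IsStableWith A c p u

/-! ### The auxiliary graph -/

/-- The auxiliary graph for ID-codes in strips of height `h`: the vertices are the `2`-labelings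
of the strip with four columns, the arcs are the pairs `(u, v)` such that `u` is `I`-compatible
with `v`, and the length of `(u, v)` is the number of vertices of the fifth column that `u ▷ v`
labels `1`. -/
noncomputable def auxGraph (𝒢 : Grid) (h : ℕ) : LengthDigraph (Labeling h 4) where
  Adj u v := ICompatible 𝒢 u v
  length u v _ :=
    (Finset.univ.filter fun w : StripVertex h 5 => w.1.2 = 5 ∧ concat u v w = 1).card

end IDStrip

namespace IDStrip

namespace MinPlusMatrix

/-! Enlarging a code preserves domination and separation, so relabeling whole columns by 1 turns
walks of the auxiliary graph into walks. Hence, once an arc exists, the all-ones labeling has a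
loop, and for every walk with at least 4 steps it is reached from the start, and reaches the end, in
exactly 4 steps (`isHub_ones`). Without arcs the matrix is constantly `∞`.

A hub replaces strong connectivity (`IsHub.isStable`). Let `L / k` be the least mean weight of a
closed walk and `f i` the least weight of a walk of length `i` between fixed ends. Deleting closed
walks bounds the excess `k * f i - L * i` below; detouring through the hub to an optimal closed walk
bounds it above. Partial weights of a long optimal walk are confined likewise, so by pigeonhole it
contains a closed walk of mean exactly `L / k`. Repeating that walk gives `f (i + p) ≤ f i + c` with
`k * c = L * p`: the excess decreases weakly along steps of `p`, and being an integer bounded below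
it is eventually `p`-periodic. -/

theorem untrop_mul_apply {V : Type*} [Fintype V] (A B : MinPlusMatrix V) (u v : V) :
    Tropical.untrop ((A * B) u v) =
      Finset.univ.inf fun w => Tropical.untrop (A u w) + Tropical.untrop (B w v) := by
  rw [Matrix.mul_apply, Finset.untrop_sum']
  rfl

/-! ### Weighted walks and matrix powers -/

variable {V : Type*} [Fintype V] [DecidableEq V]

/-- There is a walk of length `i` from `u` to `v` of weight at most `x`. -/
def HasWalk (A : MinPlusMatrix V) (i : ℕ) (u v : V) (x : ℕ) : Prop :=
  Tropical.untrop ((A ^ i) u v) ≤ (x : ℕ∞)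

variable {A : MinPlusMatrix V} {i j : ℕ} {u v w : V} {x y : ℕ}

theorem HasWalk.mono (h : A.HasWalk i u v x) (hxy : x ≤ y) : A.HasWalk i u v y :=
  le_trans h (by exact_mod_cast hxy)

theorem HasWalk.refl (A : MinPlusMatrix V) (u : V) : A.HasWalk 0 u u 0 := by
  simp [HasWalk]

theorem HasWalk.trans (h₁ : A.HasWalk i u w x) (h₂ : A.HasWalk j w v y) :
    A.HasWalk (i + j) u v (x + y) := by
  unfold HasWalk at *
  rw [pow_add, untrop_mul_apply, Nat.cast_add]
  exact (Finset.inf_le (Finset.mem_univ w)).trans (add_le_add h₁ h₂)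

theorem hasWalk_zero_iff : A.HasWalk 0 u v x ↔ u = v := by
  by_cases h : u = v
  · simp [HasWalk, h]
  · simp [HasWalk, h]

theorem HasWalk.exists_split (h : A.HasWalk (i + j) u v x) :
    ∃ w y z, y + z = x ∧ A.HasWalk i u w y ∧ A.HasWalk j w v z := by
  unfold HasWalk at *
  rw [pow_add, untrop_mul_apply] at h
  obtain ⟨w, -, hw⟩ := Finset.exists_mem_eq_inf Finset.univ ⟨u, Finset.mem_univ u⟩
    fun w => Tropical.untrop ((A ^ i) u w) + Tropical.untrop ((A ^ j) w v)
  rw [hw] at h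
  have hfin := ne_top_of_le_ne_top (ENat.natCast_ne_top x) h
  obtain ⟨h₁, h₂⟩ := WithTop.add_ne_top.1 hfin
  obtain ⟨a, ha⟩ := ENat.ne_top_iff_exists.1 h₁
  obtain ⟨b, hb⟩ := ENat.ne_top_iff_exists.1 h₂
  rw [← ha, ← hb] at h
  have hab : a + b ≤ x := by exact_mod_cast h
  refine ⟨w, a, x - a, by omega, ha.symm.le, ?_⟩
  rw [← hb]
  exact_mod_cast (by omega : b ≤ x - a)

theorem HasWalk.iterate (h : A.HasWalk i u u x) (q : ℕ) : A.HasWalk (q * i) u u (q * x) := by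
  induction q with
  | zero => simpa using HasWalk.refl A u
  | succ q ih => simpa [Nat.succ_mul] using ih.trans h

/-- The vertices `w` of a walk of length `i`, with its partial weights `S`. -/
theorem HasWalk.exists_walk (h : A.HasWalk i u v x) :
    ∃ (w : ℕ → V) (S : ℕ → ℕ), w 0 = u ∧ w i = v ∧ S 0 = 0 ∧ S i ≤ x ∧
      ∀ s t, s + t ≤ i → S s ≤ S (s + t) ∧
        A.HasWalk t (w s) (w (s + t)) (S (s + t) - S s) := by
  induction i generalizing v x with
  | zero =>
    have huv := hasWalk_zero_iff.1 h
    subst huv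
    refine ⟨fun _ => u, fun _ => 0, rfl, rfl, rfl, Nat.zero_le x, fun s t hst => ?_⟩
    obtain rfl : t = 0 := by omega
    simpa using HasWalk.refl A u
  | succ i ih =>
    obtain ⟨z, y, y', hy, h₁, h₂⟩ := h.exists_split
    obtain ⟨w, S, hw0, hwi, hS0, hSi, hS⟩ := ih h₁
    refine ⟨Function.update w (i + 1) v, Function.update S (i + 1) x, ?_, ?_, ?_, ?_, ?_⟩
    · simp [hw0]
    · simp
    · simp [hS0]
    · simp
    · intro s t hst
      rcases Nat.lt_or_ge (s + t) (i + 1) with hlt | hge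
      · have e₁ : s ≠ i + 1 := by omega
        have e₂ : s + t ≠ i + 1 := by omega
        simpa [Function.update_of_ne, e₁, e₂] using hS s t (by omega)
      · have e₂ : s + t = i + 1 := by omega
        rw [e₂]
        rcases Nat.eq_zero_or_pos t with rfl | ht
        · obtain rfl : s = i + 1 := by omega
          simpa using HasWalk.refl A v
        · have e₁ : s ≠ i + 1 := by omega
          obtain ⟨t, rfl⟩ : ∃ r, t = r + 1 := ⟨t - 1, by omega⟩
          have hst' : s + t = i := by omega
          obtain ⟨h₃, h₄⟩ := hS s t (by omega)
          rw [hst', hwi] at h₄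
          rw [hst'] at h₃
          simp only [Function.update_self, Function.update_of_ne e₁]
          exact ⟨by omega, (h₄.trans h₂).mono (by omega)⟩

/-- A sequence of more terms than there are values repeats a value. -/
theorem exists_lt_add_of_card_le {β : Type*} [Fintype β] {n : ℕ} (hn : Fintype.card β ≤ n)
    (f : ℕ → β) : ∃ s m, 1 ≤ m ∧ s + m ≤ n ∧ f s = f (s + m) := by
  obtain ⟨a, b, hab, hf⟩ := Fintype.exists_ne_map_eq_of_card_lt (fun t : Fin (n + 1) => f t)
    (by simpa using Nat.lt_succ_of_le hn)
  have hab' : (a : ℕ) ≠ b := fun h => hab (Fin.ext h)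
  have ha := a.2
  have hb := b.2
  rcases Nat.lt_or_gt_of_ne hab' with h | h
  · exact ⟨a, b - a, by omega, by omega, by rw [hf]; congr 1; omega⟩
  · exact ⟨b, a - b, by omega, by omega, by rw [← hf]; congr 1; omega⟩

/-! ### The minimum cycle mean -/

/-- The ratio `L / k` bounds the mean weight of short closed walks from below. -/
def IsCycleMeanBound (A : MinPlusMatrix V) (k L : ℕ) : Prop :=
  ∀ m z y, 1 ≤ m → m ≤ Fintype.card V → A.HasWalk m z z y → L * m ≤ k * y

/-- Removing short closed walks bounds the weight of every walk from below. -/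
theorem IsCycleMeanBound.le_weight {k L : ℕ} (hb : A.IsCycleMeanBound k L)
    (h : A.HasWalk i u v x) : L * i ≤ k * x + L * Fintype.card V := by
  induction i using Nat.strong_induction_on generalizing x with
  | _ i ih =>
    rcases Nat.lt_or_ge i (Fintype.card V) with hi | hi
    · exact (Nat.mul_le_mul_left L hi.le).trans (Nat.le_add_left _ _)
    · obtain ⟨w, S, hw0, hwi, hS0, hSi, hS⟩ := h.exists_walk
      -- The repetition occurs within the first `card V` steps, so the closed part is short enough
      -- for `hb`; induction handles the rest.
      obtain ⟨s, m, hm, hsm, hw⟩ := exists_lt_add_of_card_le le_rfl w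
      obtain ⟨t, rfl⟩ : ∃ t, i = s + m + t := ⟨i - (s + m), by omega⟩
      obtain ⟨a₁, b₁⟩ := hS 0 s (by omega)
      obtain ⟨a₂, b₂⟩ := hS s m (by omega)
      obtain ⟨a₃, b₃⟩ := hS (s + m) t le_rfl
      rw [zero_add, hw0, hS0] at b₁
      rw [← hw] at b₂ b₃
      rw [hwi] at b₃
      have h₁ := hb m _ _ hm (by omega) b₂
      have h₂ := ih (s + t) (by omega) (b₁.trans b₃)
      rw [Nat.sub_zero] at h₂
      zify [a₂, a₃] at h₁ h₂ hSi ⊢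
      have hk : (k : ℤ) * S (s + m + t) ≤ k * x := by gcongr
      linarith

/-- A nonempty family of closed walks has one of least mean weight. -/
theorem exists_isCycleMeanBound (h : A.HasWalk 1 u u x) :
    ∃ k L z, 1 ≤ k ∧ A.HasWalk k z z L ∧ A.IsCycleMeanBound k L := by
  classical
  let T : Finset (ℕ × V) := (Finset.Icc 1 (Fintype.card V) ×ˢ Finset.univ).filter
    fun q => Tropical.untrop ((A ^ q.1) q.2 q.2) ≠ ⊤
  have hT : T.Nonempty := by
    refine ⟨(1, u), ?_⟩
    simp only [T, Finset.mem_filter, Finset.mem_product, Finset.mem_Icc, Finset.mem_univ, and_true,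
      le_refl, true_and]
    exact ⟨Fintype.card_pos_iff.2 ⟨u⟩, ne_top_of_le_ne_top (ENat.natCast_ne_top x) h⟩
  obtain ⟨⟨k, z⟩, hkT, hmin⟩ := T.exists_min_image
    (fun q => ((Tropical.untrop ((A ^ q.1) q.2 q.2)).toNat : ℚ) / q.1) hT
  simp only [T, Finset.mem_filter, Finset.mem_product, Finset.mem_Icc, Finset.mem_univ,
    and_true] at hkT hmin
  refine ⟨k, (Tropical.untrop ((A ^ k) z z)).toNat, z, hkT.1.1,
    (ENat.natCast_toNat hkT.2).symm.le, fun m w y hm hmn hy => ?_⟩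
  have hfin : Tropical.untrop ((A ^ m) w w) ≠ ⊤ :=
    ne_top_of_le_ne_top (ENat.natCast_ne_top y) hy
  have hle := hmin (m, w) ⟨⟨hm, hmn⟩, hfin⟩
  have hk0 : (0 : ℚ) < k := by exact_mod_cast hkT.1.1
  have hm0 : (0 : ℚ) < m := by exact_mod_cast hm
  rw [div_le_div_iff₀ hk0 hm0] at hle
  have hy' : (Tropical.untrop ((A ^ m) w w)).toNat ≤ y := ENat.toNat_le_of_le_natCast hy
  have hle' : (Tropical.untrop ((A ^ k) z z)).toNat * m ≤
      (Tropical.untrop ((A ^ m) w w)).toNat * k := by exact_mod_cast hle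
  nlinarith

/-- Walks of a given length can be chosen of bounded weight. -/
theorem exists_forall_hasWalk (A : MinPlusMatrix V) (i : ℕ) :
    ∃ E, ∀ u v x, A.HasWalk i u v x → A.HasWalk i u v E := by
  -- `toNat` sends `⊤` to 0, so this sum dominates every finite entry.
  refine ⟨∑ u, ∑ v, (Tropical.untrop ((A ^ i) u v)).toNat, fun u v x h => ?_⟩
  have hfin := ne_top_of_le_ne_top (ENat.natCast_ne_top x) h
  refine HasWalk.mono (ENat.natCast_toNat hfin).symm.le ?_
  exact (Finset.single_le_sum (f := fun v => (Tropical.untrop ((A ^ i) u v)).toNat)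
      (fun _ _ => Nat.zero_le _) (Finset.mem_univ v)).trans
    (Finset.single_le_sum (f := fun u => ∑ v, (Tropical.untrop ((A ^ i) u v)).toNat)
      (fun _ _ => Nat.zero_le _) (Finset.mem_univ u))

/-! ### Stability from a hub -/

/-- A vertex `J` is a hub of order `K` if it has a loop, and every long enough walk can be
rerouted through `J`, with `K` steps to reach `J` and `K` steps from `J`. -/
structure IsHub (A : MinPlusMatrix V) (J : V) (K : ℕ) : Prop where
  loop : ∃ x, A.HasWalk 1 J J x
  route : ∀ i u v x, K ≤ i → A.HasWalk i u v x →
    (∃ y, A.HasWalk K u J y) ∧ ∃ y, A.HasWalk K J v y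

variable {J : V} {K : ℕ}

/-- Through the hub and a closed walk of mean weight `L / k`, walks of every large length exist
whose weight exceeds the proportional one by a bounded amount. -/
theorem IsHub.exists_weight_le (hJ : A.IsHub J K) {k L : ℕ} {z : V} (hk : 1 ≤ k)
    (hz : A.HasWalk k z z L) :
    ∃ D N, ∀ i u v j x, N ≤ i → K ≤ j → A.HasWalk j u v x →
      ∃ y, A.HasWalk i u v y ∧ k * y ≤ L * i + D := by
  obtain ⟨ℓ, hℓ⟩ := hJ.loop
  obtain ⟨E, hE⟩ := A.exists_forall_hasWalk K
  have hzK := hz.iterate K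
  -- `K` turns make the closed walk long enough to be rerouted, which connects `z` with `J` both
  -- ways.
  obtain ⟨⟨a, ha⟩, b, hb⟩ := hJ.route (K * k) z z _ (Nat.le_mul_of_pos_right K hk) hzK
  -- Four legs of length `K`: `u → J → z → J → v`. Fewer than `k` loops at `J` correct the length
  -- modulo `k`.
  refine ⟨k * (E + k * ℓ + b + a + E), 4 * K, fun i u v j x hi hj h => ?_⟩
  obtain ⟨⟨e, he⟩, e', he'⟩ := hJ.route j u v x hj h
  obtain ⟨q, r, hr, hqr⟩ : ∃ q r, r < k ∧ i = 4 * K + r + q * k :=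
    ⟨(i - 4 * K) / k, (i - 4 * K) % k, Nat.mod_lt _ hk, by
      have := Nat.mod_add_div' (i - 4 * K) k
      omega⟩
  have hw := ((((hE _ _ _ he).trans (hℓ.iterate r)).trans hb).trans
    ((hz.iterate q).trans ha)).trans (hE _ _ _ he')
  have hlen : K + r * 1 + K + (q * k + K) + K = i := by omega
  rw [hlen] at hw
  refine ⟨_, hw, ?_⟩
  have h₁ : r * ℓ ≤ k * ℓ := Nat.mul_le_mul_right ℓ hr.le
  have h₂ : k * (q * L) ≤ L * i := by
    rw [hqr]
    nlinarith [Nat.zero_le (L * (4 * K + r))]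
  nlinarith [Nat.mul_le_mul_left k h₁]

/-- Repeating a critical closed walk met by an optimal walk lengthens the walk at the critical
rate. -/
theorem IsHub.exists_period (hJ : A.IsHub J K) {k L : ℕ} {z : V} (hk : 1 ≤ k)
    (hz : A.HasWalk k z z L) (hb : A.IsCycleMeanBound k L) :
    ∃ p c N, 1 ≤ p ∧ k * c = L * p ∧
      ∀ i u v x, N ≤ i → A.HasWalk i u v x → A.HasWalk (i + p) u v (x + c) := by
  obtain ⟨D, N, hD⟩ := hJ.exists_weight_le hk hz
  let n := Fintype.card V
  let M := Fintype.card (V × Fin (D + 2 * (L * n) + 1))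
  -- `M` counts the pairs (vertex, excess), and every `m` with `1 ≤ m ≤ M` divides `M!`.
  refine ⟨k * M.factorial, L * M.factorial, max (max N K) M, ?_, by ring, ?_⟩
  · exact Nat.mul_pos hk M.factorial_pos
  intro i u v x hi h
  have hNi : N ≤ i := by omega
  have hKi : K ≤ i := by omega
  have hMi : M ≤ i := by omega
  obtain ⟨y, hy, hyx, hyD⟩ : ∃ y, A.HasWalk i u v y ∧ y ≤ x ∧ k * y ≤ L * i + D := by
    obtain ⟨y, hy, hyD⟩ := hD i u v i x hNi hKi h
    rcases le_total x y with hxy | hxy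
    · exact ⟨x, h, le_rfl, (Nat.mul_le_mul_left k hxy).trans hyD⟩
    · exact ⟨y, hy, hxy, hyD⟩
  obtain ⟨w, S, hw0, hwi, hS0, hSi, hS⟩ := hy.exists_walk
  -- The lower bound comes from the prefix, the upper one from the suffix and the near-optimal
  -- total.
  have hρ : ∀ s, s ≤ i → L * s ≤ k * S s + L * n ∧ k * S s ≤ L * s + D + L * n := by
    intro s hs
    obtain ⟨t, rfl⟩ : ∃ t, i = s + t := ⟨i - s, by omega⟩
    obtain ⟨-, b₁⟩ := hS 0 s (by omega)
    obtain ⟨a₂, b₂⟩ := hS s t le_rfl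
    have h₁ := hb.le_weight b₁
    have h₂ := hb.le_weight b₂
    rw [zero_add, hS0, Nat.sub_zero] at h₁
    refine ⟨h₁, ?_⟩
    zify [a₂] at h₂ hSi hyD ⊢
    have hk' : (k : ℤ) * S (s + t) ≤ k * y := by gcongr
    linarith
  -- Adding `L * n` makes the excess nonnegative and, by `hρ`, smaller than the modulus, so
  -- `Fin.ofNat` loses nothing.
  obtain ⟨s, m, hm, hsm, hw⟩ := exists_lt_add_of_card_le (le_refl M) fun s =>
    (w s, Fin.ofNat (D + 2 * (L * n) + 1) (k * S s + L * n - L * s))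
  simp only [Prod.mk.injEq] at hw
  obtain ⟨hw, hρeq⟩ := hw
  obtain ⟨t, rfl⟩ : ∃ t, i = s + m + t := ⟨i - (s + m), by omega⟩
  obtain ⟨l₁, u₁⟩ := hρ s (by omega)
  obtain ⟨l₂, u₂⟩ := hρ (s + m) (by omega)
  have hval := congrArg Fin.val hρeq
  simp only [Fin.ofNat] at hval
  rw [Nat.mod_eq_of_lt (by omega), Nat.mod_eq_of_lt (by omega)] at hval
  obtain ⟨a₁, b₁⟩ := hS 0 s (by omega)
  obtain ⟨a₂, b₂⟩ := hS s m (by omega)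
  obtain ⟨a₃, b₃⟩ := hS (s + m) t le_rfl
  rw [zero_add, hw0, hS0] at b₁
  rw [← hw] at b₂
  rw [hwi] at b₃
  have hcrit : k * (S (s + m) - S s) = L * m := by
    have : L * (s + m) = L * s + L * m := by ring
    have : k * S (s + m) = k * S s + L * m := by omega
    rw [Nat.mul_sub]
    omega
  obtain ⟨g, hg⟩ : m ∣ M.factorial := Nat.dvd_factorial hm (by omega)
  have hrep := b₂.iterate (k * g)
  have e₁ : k * g * m = k * M.factorial := by rw [hg]; ring
  have e₂ : k * g * (S (s + m) - S s) = L * M.factorial := by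
    rw [hg, mul_right_comm, hcrit]; ring
  rw [e₁, e₂] at hrep
  have hall := ((b₁.trans hrep).trans b₂).trans (hw ▸ b₃)
  have e₃ : s + k * M.factorial + m + t = s + m + t + k * M.factorial := by ring
  rw [e₃] at hall
  exact hall.mono (by omega)

/-- A sequence that is bounded below and antitone along steps of length `p` is eventually
periodic of period `p`. -/
theorem eventually_periodic_of_add_le {f : ℕ → ℤ} {p N : ℕ} {D : ℤ} (hD : ∀ i, N ≤ i → D ≤ f i)
    (h : ∀ i, N ≤ i → f (i + p) ≤ f i) : ∀ᶠ i in Filter.atTop, f (i + p) = f i := by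
  -- Sums over windows of length `p` are antitone and bounded below, hence eventually constant.
  let F : ℕ → ℤ := fun i => ∑ j ∈ Finset.range p, f (N + i + j)
  have hstep : ∀ i, F (i + 1) - F i = f (N + i + p) - f (N + i) := by
    intro i
    have h₁ := Finset.sum_range_succ (fun j => f (N + i + j)) p
    have h₂ := Finset.sum_range_succ' (fun j => f (N + i + j)) p
    have h₃ : F (i + 1) = ∑ j ∈ Finset.range p, f (N + i + (j + 1)) :=
      Finset.sum_congr rfl fun j _ => by congr 1; ring
    simp only [add_zero] at h₂
    simp only [h₃, F]
    linarith
  have hbound : ∀ i, p * D ≤ F i := by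
    intro i
    have := Finset.card_nsmul_le_sum (Finset.range p) (fun j => f (N + i + j)) D
      fun j _ => hD _ (by omega)
    simpa using this
  have hanti : Antitone fun i => (F i - p * D).toNat := antitone_nat_of_succ_le fun i => by
    have := hstep i
    have := h (N + i) (by omega)
    omega
  obtain ⟨T, hT⟩ := WellFoundedGT.monotone_chain_condition
    (⟨fun i => OrderDual.toDual (F i - p * D).toNat, fun a b hab => hanti hab⟩ : ℕ →o ℕᵒᵈ)
  have hF : ∀ i, T ≤ i → (F T - p * D).toNat = (F i - p * D).toNat := hT
  filter_upwards [Filter.eventually_ge_atTop (N + T)] with i hi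
  obtain ⟨j, rfl⟩ : ∃ j, i = N + j := ⟨i - N, by omega⟩
  have h₁ := hF j (by omega)
  have h₂ := hF (j + 1) (by omega)
  have h₃ := hstep j
  have h₄ := hbound j
  have h₅ := hbound (j + 1)
  omega

/-- A matrix with a hub is stable. -/
theorem IsHub.isStable (hJ : A.IsHub J K) : A.IsStable := by
  obtain ⟨ℓ, hℓ⟩ := hJ.loop
  obtain ⟨k, L, z, hk, hz, hb⟩ := exists_isCycleMeanBound hℓ
  obtain ⟨D, N₀, hD⟩ := hJ.exists_weight_le hk hz
  obtain ⟨p, c, N, hp, hc, hN⟩ := hJ.exists_period hk hz hb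
  have hev : ∀ u v, ∀ᶠ i in Filter.atTop,
      (A ^ (i + p)) u v = MinPlusMatrix.translate (A ^ i) c u v := by
    intro u v
    -- One walk of length at least `K` makes all later entries finite; otherwise they are all `∞`.
    by_cases hfin : ∃ j x, K ≤ j ∧ A.HasWalk j u v x
    · obtain ⟨j, x, hj, hx⟩ := hfin
      have hne : ∀ i, N₀ ≤ i → Tropical.untrop ((A ^ i) u v) ≠ ⊤ := fun i hi => by
        obtain ⟨y, hy, -⟩ := hD i u v j x hi hj hx
        exact ne_top_of_le_ne_top (ENat.natCast_ne_top y) hy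
      let f : ℕ → ℕ := fun i => (Tropical.untrop ((A ^ i) u v)).toNat
      have hf : ∀ i, N₀ ≤ i → Tropical.untrop ((A ^ i) u v) = f i := fun i hi =>
        (ENat.natCast_toNat (hne i hi)).symm
      have hper := eventually_periodic_of_add_le (f := fun i => (k * f i : ℤ) - L * i) (p := p)
        (N := max N N₀) (D := -(L * Fintype.card V)) (fun i hi => by
          have := hb.le_weight (hf i (by omega)).le
          zify at this
          linarith) (fun i hi => by
          have h₁ : A.HasWalk (i + p) u v (f i + c) := hN i u v _ (by omega) (hf i (by omega)).le
          have h₂ : f (i + p) ≤ f i + c := ENat.toNat_le_of_le_natCast h₁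
          have h₃ := Nat.mul_le_mul_left k h₂
          zify at h₃ hc
          push_cast
          linarith)
      filter_upwards [hper, Filter.eventually_ge_atTop N₀] with i hi hi₀
      have hk0 : (k : ℤ) ≠ 0 := by exact_mod_cast (by omega : k ≠ 0)
      have heq : f (i + p) = f i + c := by
        zify at hc ⊢
        apply mul_left_cancel₀ hk0
        push_cast at hi
        linarith
      apply Tropical.untrop_injective
      rw [hf (i + p) (by omega), heq, translate, Tropical.untrop_trop, hf i hi₀, Nat.cast_add]
    · push Not at hfin
      have htop : ∀ i, K ≤ i → Tropical.untrop ((A ^ i) u v) = ⊤ := fun i hi => by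
        by_contra hne
        exact hfin i _ hi (ENat.natCast_toNat hne).symm.le
      filter_upwards [Filter.eventually_ge_atTop K] with i hi
      apply Tropical.untrop_injective
      rw [htop (i + p) (by omega), translate, Tropical.untrop_trop, htop i hi, top_add]
  obtain ⟨T, hT⟩ := Filter.eventually_atTop.1
    (Filter.eventually_all.2 fun u => Filter.eventually_all.2 (hev u))
  exact ⟨c, p, max T 1, hp, le_max_right _ _, fun i hi =>
    Matrix.ext fun u v => hT i ((le_max_left _ _).trans hi) u v⟩

end MinPlusMatrix

/-! ### Monotonicity in the code -/

variable {𝒢 : Grid} {h s : ℕ}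

theorem areSeparatedBy_iff {V : Type*} {G : SimpleGraph V} {C : Set V} {u v : V} :
    AreSeparatedBy G C u v ↔
      ∃ w ∈ C, ¬(w ∈ closedNeighborSet G u ↔ w ∈ closedNeighborSet G v) := by
  unfold AreSeparatedBy
  rw [Ne, Set.ext_iff, not_forall]
  refine exists_congr fun w => ?_
  simp only [Set.mem_inter_iff]
  tauto

theorem AreSeparatedBy.mono {V : Type*} {G : SimpleGraph V} {C C' : Set V} {u v : V}
    (h : AreSeparatedBy G C u v) (hC : C ⊆ C') : AreSeparatedBy G C' u v := by
  rw [areSeparatedBy_iff] at h ⊢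
  obtain ⟨w, hw, hne⟩ := h
  exact ⟨w, hC hw, hne⟩

theorem IsDominatedBy.mono {V : Type*} {G : SimpleGraph V} {C C' : Set V} {v : V}
    (h : IsDominatedBy G C v) (hC : C ⊆ C') : IsDominatedBy G C' v :=
  Set.Nonempty.mono (Set.inter_subset_inter_right _ hC) h

theorem SatisfiesPI.mono {f g : Labeling h s} (hf : SatisfiesPI 𝒢 f) (hfg : f.code ⊆ g.code) :
    SatisfiesPI 𝒢 g := by
  intro a ha
  obtain ⟨hdom, hsep⟩ := hf a ha
  exact ⟨fun v hv => (hdom v hv).mono (Set.inter_subset_inter_left _ hfg),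
    fun u hu v hv huv => (hsep u hu v hv huv).mono (Set.inter_subset_inter_left _ hfg)⟩

open Classical in
/-- The labeling obtained from `f` by relabeling `1` all columns `j` with `P j`. -/
noncomputable def Labeling.fill (f : Labeling h s) (P : ℤ → Prop) : Labeling h s := fun v =>
  if P v.1.2 then 1 else f v

/-- The labeling with all labels `1`. -/
def Labeling.ones (h s : ℕ) : Labeling h s := fun _ => 1

theorem Labeling.fill_eq_one {f : Labeling h s} {P : ℤ → Prop} {v : StripVertex h s}
    (hv : f v = 1) : f.fill P v = 1 := by
  unfold fill
  split_ifs <;> trivial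

theorem Labeling.fill_eq_self {f : Labeling h s} {P : ℤ → Prop}
    (hP : ∀ v : StripVertex h s, ¬P v.1.2) : f.fill P = f :=
  funext fun v => if_neg (hP v)

theorem Labeling.fill_eq_ones {f : Labeling h s} {P : ℤ → Prop}
    (hP : ∀ v : StripVertex h s, P v.1.2) : f.fill P = ones h s :=
  funext fun v => if_pos (hP v)

theorem ICompatible.mono {f g f' g' : Labeling h 4} (hfg : ICompatible 𝒢 f g)
    (hc : Compatible f' g') (hf : f.code ⊆ f'.code) (hg : g.code ⊆ g'.code) :
    ICompatible 𝒢 f' g' := by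
  refine ⟨hc, hfg.2.mono fun v hv => ?_⟩
  simp only [Labeling.code, Set.mem_ofPred_eq, concat] at hv ⊢
  split_ifs at hv ⊢ with hv4
  · exact hf hv
  · exact hg hv

/-- Column `j` of `g` is column `j + 1` of `f ▷ g`, whence the shift of `P`. -/
theorem ICompatible.fill {f g : Labeling h 4} (hfg : ICompatible 𝒢 f g) (P : ℤ → Prop) :
    ICompatible 𝒢 (f.fill P) (g.fill fun j => P (j + 1)) := by
  refine hfg.mono (funext fun v => ?_) (fun _ hv => Labeling.fill_eq_one hv)
    fun _ hv => Labeling.fill_eq_one hv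
  have := congrFun hfg.1 v
  simp only [Labeling.restrict, Labeling.fill, Nat.cast_one, Nat.cast_zero, add_zero] at this ⊢
  rw [this]
  congr 2
  simp

theorem ICompatible.ones {f g : Labeling h 4} (hfg : ICompatible 𝒢 f g) :
    ICompatible 𝒢 (Labeling.ones h 4) (Labeling.ones h 4) :=
  hfg.mono rfl (fun _ _ => rfl) fun _ _ => rfl

theorem hasWalk_one_of_iCompatible {f g : Labeling h 4} (hfg : ICompatible 𝒢 f g) :
    ∃ x, (auxGraph 𝒢 h).lengthMatrix.HasWalk 1 f g x := by
  have hadj : (auxGraph 𝒢 h).Adj f g := hfg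
  refine ⟨(auxGraph 𝒢 h).length f g hadj, ?_⟩
  rw [MinPlusMatrix.HasWalk, pow_one, LengthDigraph.lengthMatrix, dif_pos hadj,
    Tropical.untrop_trop]

theorem iCompatible_of_hasWalk_one {f g : Labeling h 4} {x : ℕ}
    (hx : (auxGraph 𝒢 h).lengthMatrix.HasWalk 1 f g x) : ICompatible 𝒢 f g := by
  by_contra hfg
  have hadj : ¬(auxGraph 𝒢 h).Adj f g := hfg
  rw [MinPlusMatrix.HasWalk, pow_one, LengthDigraph.lengthMatrix, dif_neg hadj,
    Tropical.untrop_trop, top_le_iff] at hx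
  exact ENat.natCast_ne_top x hx

/-! ### The all-ones hub -/

/-- Walks of the auxiliary graph may be filled along a set of columns. -/
theorem exists_hasWalk_fill {i : ℕ} {f g : Labeling h 4} {x : ℕ}
    (hx : (auxGraph 𝒢 h).lengthMatrix.HasWalk i f g x) (P : ℤ → Prop) :
    ∃ y, (auxGraph 𝒢 h).lengthMatrix.HasWalk i (f.fill P) (g.fill fun j => P (j + i)) y := by
  induction i generalizing g x with
  | zero =>
    obtain rfl := MinPlusMatrix.hasWalk_zero_iff.1 hx
    simpa using ⟨0, MinPlusMatrix.HasWalk.refl _ _⟩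
  | succ i ih =>
    obtain ⟨w, y, z, -, h₁, h₂⟩ := hx.exists_split
    obtain ⟨y', hy'⟩ := ih h₁
    obtain ⟨z', hz'⟩ := hasWalk_one_of_iCompatible
      ((iCompatible_of_hasWalk_one h₂).fill fun j => P (j + i))
    refine ⟨y' + z', ?_⟩
    convert hy'.trans hz' using 4 with j
    push_cast
    ring

theorem stripVertex_column_bounds (v : StripVertex h s) : 1 ≤ v.1.2 ∧ v.1.2 ≤ s := by
  have := v.2
  simp only [stripPoints, Finset.mem_product, Finset.mem_Icc] at this
  exact this.2

theorem isHub_ones {f g : Labeling h 4} (hfg : ICompatible 𝒢 f g) :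
    (auxGraph 𝒢 h).lengthMatrix.IsHub (Labeling.ones h 4) 4 where
  loop := hasWalk_one_of_iCompatible hfg.ones
  route i u v x hi hx := by
    constructor
    · obtain ⟨j, rfl⟩ := Nat.exists_eq_add_of_le hi
      obtain ⟨w, y, -, -, hy, -⟩ := hx.exists_split
      -- Columns 5 to 8 of the walk are exactly those of the labeling reached after four steps.
      obtain ⟨y', hy'⟩ := exists_hasWalk_fill hy fun j => 4 < j
      rw [Labeling.fill_eq_self fun v => by have := stripVertex_column_bounds v; omega,
        Labeling.fill_eq_ones fun v => by
          have := stripVertex_column_bounds v; push_cast; omega] at hy'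
      exact ⟨y', hy'⟩
    · obtain ⟨j, rfl⟩ := Nat.exists_eq_add_of_le' hi
      obtain ⟨w, -, y, -, -, hy⟩ := hx.exists_split
      obtain ⟨y', hy'⟩ := exists_hasWalk_fill hy fun j => j ≤ 4
      rw [Labeling.fill_eq_ones fun v => by have := stripVertex_column_bounds v; omega,
        Labeling.fill_eq_self fun v => by
          have := stripVertex_column_bounds v; push_cast; omega] at hy'
      exact ⟨y', hy'⟩

/-- The matrix of a graph without arcs is stable. -/
theorem MinPlusMatrix.isStable_zero {V : Type*} [Fintype V] [DecidableEq V] :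
    (0 : MinPlusMatrix V).IsStable := by
  refine ⟨0, 1, 1, le_rfl, le_rfl, fun i hi => ?_⟩
  rw [zero_pow (by omega), zero_pow (by omega)]
  ext u v
  simp [translate]

end IDStrip

theorem mainTheorem3 (𝒢 : IDStrip.Grid) (h : ℕ) (hh : 1 ≤ h) :
    IDStrip.MinPlusMatrix.IsStable (IDStrip.auxGraph 𝒢 h).lengthMatrix := by
  by_cases hex : ∃ f g : IDStrip.Labeling h 4, IDStrip.ICompatible 𝒢 f g
  · obtain ⟨f, g, hfg⟩ := hex
    exact (IDStrip.isHub_ones hfg).isStable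
  · push Not at hex
    -- The zero of `Tropical ℕ∞` is `∞`.
    have hzero : (IDStrip.auxGraph 𝒢 h).lengthMatrix = 0 :=
      Matrix.ext fun f g => dif_neg (hex f g)
    rw [hzero]
    exact IDStrip.MinPlusMatrix.isStable_zero
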